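/- Let $q \geq 2$ and $s \geq 2$ be integers. Write $e(x) = e^{2\pi i x}$ and $[N] = \{0,1,\dots,N-1\}$. A sequence $f \colon \mathbb{N}_0 \to \{z \in \mathbb{C} : |z| = 1\}$ is $q$-multiplicative if $f(m+n) = f(m)f(n)$ whenever $t, m, n \in \mathbb{N}_0$, $m < q^t$ and $q^t \mid n$. For $N \geq 1$ let $\Pi(N)$ be the set of $\vec n = (n_0,\dots,n_s) \in \mathbb{Z}^{s+1}$ such that $n_0 + \omega_1 n_1 + \dots + \omega_s n_s \in [N]$ for all $\omega \in \{0,1\}^s$, and let the Gowers norm $\|f\|_{U^s[N]} \geq 0$ be given by $$\|f\|_{U^s[N]}^{2^s} = \frac{1}{|\Pi(N)|} \sum_{\vec n \in \Pi(N)} \prod_{\omega \in \{0,1\}^s} \mathcal{C}^{\omega_1 + \dots + \omega_s} f(n_0 + \omega_1 n_1 + \dots + \omega_s n_s),$$ where $\mathcal{C}$ is complex conjugation (the right-hand side is a nonnegative real number). There exist an integer $l_0 \geq 0$, a function $h \colon \mathbb{R}_{>0} \to \mathbb{R}_{>0}$ with $h(\varepsilon) \to 0$ as $\varepsilon \to 0$,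 and a constant $C > 0$, all depending only on $q$ and $s$, such that the following holds. Let $f$ be a $q$-multiplicative sequence, let $\varepsilon > 0$, and let $L \geq l_0$ be an integer such that $\|f\|_{U^s[q^L]} > 1 - \varepsilon$. Then there exist $\alpha, \beta \in \mathbb{R}$ such that, for all but at most $h(\varepsilon)\,|X|$ elements $n$ of the set $X = \{n \in \mathbb{N}_0 : n < q^L,\ q^{l_0} \mid n\}$, there is $\theta \in \mathbb{R}$ with $|\theta| \leq C\,h(\varepsilon)$ and $f(n) = e(n\alpha + \beta + \theta)$. -/

import Mathlib

open Filter Topology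

namespace QMult

/-- A sequence `f : ℕ → ℂ` with values on the unit circle is `q`-multiplicative if
`f (m + n) = f m * f n` whenever `m < q ^ t` and `q ^ t ∣ n` for some `t`. -/
structure IsQMultiplicative (q : ℕ) (f : ℕ → ℂ) : Prop where
  norm_eq_one : ∀ n, ‖f n‖ = 1
  map_add : ∀ t m n : ℕ, m < q ^ t → q ^ t ∣ n → f (m + n) = f m * f n

/-- `e x = exp (2 π i x)`. -/
noncomputable def e (x : ℝ) : ℂ := Complex.exp (2 * Real.pi * Complex.I * x)

/-- The vertex `1ω · v = v₀ + ω₁ v₁ + ⋯ + ω_s v_s` of the parallelepiped `v ∈ ℤ^{s+1}`. -/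
def vertex {s : ℕ} (v : Fin (s + 1) → ℤ) (ω : Fin s → Fin 2) : ℤ :=
  v 0 + ∑ i, ((ω i : ℕ) : ℤ) * v i.succ

/-- `Π(N)`: the `s`-dimensional parallelepipeds in `[N] = {0, …, N - 1}`, that is, the
`v ∈ ℤ^{s+1}` all of whose vertices lie in `[N]`. The bounding box is only there to make the
set a `Finset` and imposes no restriction, see `mem_parallelepipeds`. -/
noncomputable def parallelepipeds (s N : ℕ) : Finset (Fin (s + 1) → ℤ) :=
  (Fintype.piFinset fun _ => Finset.Ioo (-(N : ℤ)) N).filter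
    fun v => ∀ ω : Fin s → Fin 2, 0 ≤ vertex v ω ∧ vertex v ω < N

theorem mem_parallelepipeds {s N : ℕ} {v : Fin (s + 1) → ℤ} :
    v ∈ parallelepipeds s N ↔ ∀ ω : Fin s → Fin 2, 0 ≤ vertex v ω ∧ vertex v ω < N := by
  classical
  simp only [parallelepipeds, Finset.mem_filter, Fintype.mem_piFinset, Finset.mem_Ioo,
    and_iff_right_iff_imp]
  intro h
  have h0 : 0 ≤ v 0 ∧ v 0 < N := by simpa [vertex] using h (fun _ => 0)
  intro i
  refine Fin.cases ⟨by omega, h0.2⟩ (fun j => ?_) i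
  have hj := h (fun k => if k = j then 1 else 0)
  have : vertex v (fun k => if k = j then 1 else 0) = v 0 + v j.succ := by
    simp only [vertex, add_right_inj]
    rw [Finset.sum_eq_single j]
    · simp
    · intro b _ hb
      simp [hb]
    · simp
  rw [this] at hj
  constructor <;> omega

/-- `|ω| = ω₁ + ⋯ + ω_s`. -/
def weight {s : ℕ} (ω : Fin s → Fin 2) : ℕ := ∑ i, (ω i : ℕ)

/-- The average, over all parallelepipeds in `[N]`, of the product over `ω ∈ {0,1}^s` of
`conj^{|ω|} f (1ω · v)`, where `conj` is complex conjugation. -/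
noncomputable def gowersAverage (s N : ℕ) (f : ℕ → ℂ) : ℂ :=
  (∑ v ∈ parallelepipeds s N, ∏ ω : Fin s → Fin 2,
    (starRingEnd ℂ)^[weight ω] (f (vertex v ω).toNat)) / ((parallelepipeds s N).card : ℂ)

/-- The Gowers uniformity norm `‖f‖_{U^s[N]}`: the `2^s`-th root of the average above, which
is a nonnegative real number for `s ≥ 1`, see `gowersAverage_nonneg` and `gowersNorm_pow`. -/
noncomputable def gowersNorm (s N : ℕ) (f : ℕ → ℂ) : ℝ :=
  (gowersAverage s N f).re ^ ((1 : ℝ) / 2 ^ s)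

theorem vertex_cons {t : ℕ} (x k : ℤ) (h : Fin t → ℤ) (a : Fin 2) (ω : Fin t → Fin 2) :
    vertex (Fin.cons x (Fin.cons k h)) (Fin.cons a ω : Fin (t + 1) → Fin 2) =
      vertex (Fin.cons (x + ((a : ℕ) : ℤ) * k) h) ω := by
  simp [vertex, Fin.sum_univ_succ, add_assoc]

theorem weight_cons {t : ℕ} (a : Fin 2) (ω : Fin t → Fin 2) :
    weight (Fin.cons a ω : Fin (t + 1) → Fin 2) = a + weight ω := by
  simp [weight, Fin.sum_univ_succ]

theorem forall_cube_succ {t : ℕ} (P : (Fin (t + 1) → Fin 2) → Prop) :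
    (∀ ω, P ω) ↔ (∀ ω : Fin t → Fin 2, P (Fin.cons 0 ω)) ∧ ∀ ω : Fin t → Fin 2,
      P (Fin.cons 1 ω) := by
  rw [Fin.forall_fin_succ_pi, Fin.forall_fin_two]

theorem prod_cube_succ {t : ℕ} (P : (Fin (t + 1) → Fin 2) → ℂ) :
    ∏ ω, P ω = (∏ ω : Fin t → Fin 2, P (Fin.cons 0 ω)) * ∏ ω : Fin t → Fin 2,
      P (Fin.cons 1 ω) := by
  rw [← (Fin.consEquiv (fun _ => Fin 2)).prod_comp, Fintype.prod_prod_type, Fin.prod_univ_two]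
  rfl

theorem mem_parallelepipeds_cons {t N : ℕ} {x y : ℤ} {h : Fin t → ℤ} :
    (Fin.cons x (Fin.cons (y - x) h) : Fin (t + 2) → ℤ) ∈ parallelepipeds (t + 1) N ↔
      (Fin.cons x h : Fin (t + 1) → ℤ) ∈ parallelepipeds t N ∧
      (Fin.cons y h : Fin (t + 1) → ℤ) ∈ parallelepipeds t N := by
  simp only [mem_parallelepipeds]
  rw [forall_cube_succ]
  simp [vertex_cons]

open scoped ComplexOrder in
theorem gowersAverage_nonneg {s : ℕ} (hs : 1 ≤ s) (N : ℕ) (f : ℕ → ℂ) :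
    0 ≤ gowersAverage s N f := by
  classical
  obtain ⟨t, rfl⟩ : ∃ t, s = t + 1 := ⟨s - 1, by omega⟩
  refine div_nonneg ?_ (by positivity)
  let G : (Fin (t + 1) → ℤ) → ℂ := fun v => ∏ ω : Fin t → Fin 2,
    (starRingEnd ℂ)^[weight ω] (f (vertex v ω).toNat)
  have hG : ∀ x y h, ∏ ω : Fin (t + 1) → Fin 2, (starRingEnd ℂ)^[weight ω]
      (f (vertex (Fin.cons x (Fin.cons (y - x) h)) ω).toNat) =
      G (Fin.cons x h) * (starRingEnd ℂ) (G (Fin.cons y h)) := by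
    intro x y h
    rw [prod_cube_succ, map_prod]
    simp only [vertex_cons, weight_cons, G]
    simp [add_comm 1, Function.iterate_succ_apply']
  let B : Finset (Fin t → ℤ) := Fintype.piFinset fun _ => Finset.Ioo (-(N : ℤ)) N
  let S : (Fin t → ℤ) → Finset ℤ := fun h => (Finset.Ioo (-(N : ℤ)) N).filter
    fun x => (Fin.cons x h : Fin (t + 1) → ℤ) ∈ parallelepipeds t N
  have hS : ∀ h x, x ∈ S h ↔ (Fin.cons x h : Fin (t + 1) → ℤ) ∈ parallelepipeds t N := by
    intro h x
    simp only [S, Finset.mem_filter, and_iff_right_iff_imp]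
    intro hx
    have := (Finset.mem_filter.1 hx).1
    rw [Fintype.mem_piFinset] at this
    simpa using this 0
  have hB : ∀ h x, (Fin.cons x h : Fin (t + 1) → ℤ) ∈ parallelepipeds t N → h ∈ B := by
    intro h x hx
    have := (Finset.mem_filter.1 hx).1
    rw [Fintype.mem_piFinset] at this
    exact Fintype.mem_piFinset.2 fun i => by simpa using this i.succ
  have key : ∑ v ∈ parallelepipeds (t + 1) N, ∏ ω : Fin (t + 1) → Fin 2,
      (starRingEnd ℂ)^[weight ω] (f (vertex v ω).toNat) =
      ∑ p ∈ B.sigma fun h => S h ×ˢ S h,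
        G (Fin.cons p.2.1 p.1) * (starRingEnd ℂ) (G (Fin.cons p.2.2 p.1)) := by
    symm
    refine Finset.sum_bij' (fun p _ => Fin.cons p.2.1 (Fin.cons (p.2.2 - p.2.1) p.1))
      (fun v _ => ⟨Fin.tail (Fin.tail v), (v 0, v 0 + v 1)⟩) ?_ ?_ ?_ ?_ ?_
    · rintro ⟨h, x, y⟩ hp
      simp only [Finset.mem_sigma, Finset.mem_product, hS] at hp
      exact mem_parallelepipeds_cons.2 hp.2
    · intro v hv
      have hv' : v = Fin.cons (v 0) (Fin.cons ((v 0 + v 1) - v 0) (Fin.tail (Fin.tail v))) := by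
        conv_lhs => rw [← Fin.cons_self_tail v, ← Fin.cons_self_tail (Fin.tail v)]
        simp [Fin.tail]
      rw [hv', mem_parallelepipeds_cons] at hv
      simp only [Finset.mem_sigma, Finset.mem_product, hS]
      exact ⟨hB _ _ hv.1, hv⟩
    · rintro ⟨h, x, y⟩ hp
      have h1 : (Fin.cons x (Fin.cons (y - x) h) : Fin (t + 2) → ℤ) 1 = y - x := rfl
      simp [h1]
    · intro v hv
      conv_rhs => rw [← Fin.cons_self_tail v, ← Fin.cons_self_tail (Fin.tail v)]
      simp [Fin.tail]
    · rintro ⟨h, x, y⟩ hp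
      exact (hG x y h).symm
  rw [key, Finset.sum_sigma]
  refine Finset.sum_nonneg fun h _ => ?_
  have hsq : ∑ p ∈ S h ×ˢ S h, G (Fin.cons p.1 h) * (starRingEnd ℂ) (G (Fin.cons p.2 h)) =
      (∑ x ∈ S h, G (Fin.cons x h)) * (starRingEnd ℂ) (∑ y ∈ S h, G (Fin.cons y h)) := by
    rw [map_sum, Finset.sum_mul_sum, Finset.sum_product]
  exact hsq ▸ mul_star_self_nonneg _

theorem gowersNorm_pow {s : ℕ} (hs : 1 ≤ s) (N : ℕ) (f : ℕ → ℂ) :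
    ((gowersNorm s N f ^ 2 ^ s : ℝ) : ℂ) = gowersAverage s N f := by
  obtain ⟨h1, h2⟩ := Complex.le_def.1 (gowersAverage_nonneg hs N f)
  have : gowersNorm s N f ^ 2 ^ s = (gowersAverage s N f).re := by
    rw [gowersNorm, ← Real.rpow_natCast, ← Real.rpow_mul (by simpa using h1)]
    simp
  rw [this]
  exact Complex.ext rfl (by simpa using h2)

/-- `Φ x` holds for `ε`-almost every `x` in the finite set `X`: the set of `x ∈ X` at which
`Φ` fails has at most `ε |X|` elements. -/
def AlmostEvery {ι : Type*} (ε : ℝ) (X : Finset ι) (Φ : ι → Prop) : Prop :=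
  ({x | x ∈ X ∧ ¬ Φ x}.ncard : ℝ) ≤ ε * (X.card : ℝ)

end QMult

namespace QMult

/-! Split the digits of a parallelepiped into windows of bounded width, each preceded by `g` guard
digits that absorb carries. A small parallelepiped `w` inserted in one window multiplies the
derivative `cubeProd f` by the unimodular number `z = cubeProd f (q ^ (i + g) • w)`
(`cubeProd_window`). Averaging over a box therefore loses a factor bounded below 1 in terms of `2 -
‖1 + z‖` at every window, and the losses multiply (`norm_sum_box_le`). A norm above `1 - ε` leaves
room only for a total loss `O(ε)`, so `∑ ‖1 - z‖ ^ 2 = O(ε)` over all positions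
(`sum_norm_one_sub_cubeProd_sq_le`).

For a suitable `w`, the number `z` is, up to conjugation, the second difference of `a ↦ f (a q ^ j)`
(`exists_cubeProd_second_difference`). So `f (a q ^ j)` is close to `f (q ^ j) ^ a` for `a ≤ q`,
with errors square-summable in `j`. The case `a = q` links consecutive digits and yields one
frequency `α` with square-summable errors (`exists_common_frequency`).

Square-summability does not bound the sum of the errors, which may grow with the number of digits.
But the digits of a uniform `n` are independent: once the means are moved into `β`, the variance of
the total error is `O(ε)` (`exists_phase_variance_le`), and Chebyshev's inequality concludes. -/

theorem IsQMultiplicative.ne_zero {q : ℕ} {f : ℕ → ℂ} (hf : IsQMultiplicative q f) (n : ℕ) :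
    f n ≠ 0 := norm_ne_zero_iff.1 (by simp [hf.norm_eq_one n])

theorem IsQMultiplicative.map_zero {q : ℕ} {f : ℕ → ℂ} (hf : IsQMultiplicative q f) :
    f 0 = 1 := by
  have h := hf.map_add 0 0 0 (by simp) (by simp)
  have h0 := hf.ne_zero 0
  rw [add_zero] at h
  exact (mul_left_cancel₀ h0 (by rw [← h, mul_one])).symm

theorem norm_iterate_conj (n : ℕ) (z : ℂ) : ‖(starRingEnd ℂ)^[n] z‖ = ‖z‖ := by
  induction n generalizing z with
  | zero => rfl
  | succ n ih => rw [Function.iterate_succ_apply, ih, RCLike.norm_conj]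

/-! ### Parallelepipeds with natural coordinates and digit windows. -/

/-- The vertex `v₀ + ω₁ v₁ + ⋯ + ω_s v_s` of a parallelepiped `v ∈ ℕ^{s+1}`. -/
def natVertex {s : ℕ} (v : Fin (s + 1) → ℕ) (ω : Fin s → Fin 2) : ℕ :=
  v 0 + ∑ i, (ω i : ℕ) * v i.succ

theorem natVertex_add {s : ℕ} (v w : Fin (s + 1) → ℕ) (ω : Fin s → Fin 2) :
    natVertex (v + w) ω = natVertex v ω + natVertex w ω := by
  simp only [natVertex, Pi.add_apply, mul_add, Finset.sum_add_distrib]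
  ring

theorem natVertex_smul {s : ℕ} (c : ℕ) (w : Fin (s + 1) → ℕ) (ω : Fin s → Fin 2) :
    natVertex (c • w) ω = c * natVertex w ω := by
  simp only [natVertex, Pi.smul_apply, smul_eq_mul, mul_add, Finset.mul_sum]
  congr 1
  exact Finset.sum_congr rfl fun _ _ => by ring

theorem natVertex_le_sum {s : ℕ} (v : Fin (s + 1) → ℕ) (ω : Fin s → Fin 2) :
    natVertex v ω ≤ ∑ j, v j := by
  rw [natVertex, Fin.sum_univ_succ]
  gcongr with i
  have : (ω i : ℕ) ≤ 1 := by omega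
  nlinarith

theorem natVertex_cons {t : ℕ} (x k : ℕ) (h : Fin t → ℕ) (a : Fin 2) (ω : Fin t → Fin 2) :
    natVertex (Fin.cons x (Fin.cons k h)) (Fin.cons a ω : Fin (t + 1) → Fin 2) =
      x + (a : ℕ) * k + ∑ i, (ω i : ℕ) * h i := by
  simp [natVertex, Fin.sum_univ_succ, add_assoc]

theorem vertex_natCast {s : ℕ} (v : Fin (s + 1) → ℕ) (ω : Fin s → Fin 2) :
    vertex (fun j => (v j : ℤ)) ω = natVertex v ω := by
  simp [vertex, natVertex]

/-- The multiplicative derivative of `f` along the parallelepiped `v`. -/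
noncomputable def cubeProd {s : ℕ} (f : ℕ → ℂ) (v : Fin (s + 1) → ℕ) : ℂ :=
  ∏ ω : Fin s → Fin 2, (starRingEnd ℂ)^[weight ω] (f (natVertex v ω))

theorem norm_cubeProd {q s : ℕ} {f : ℕ → ℂ} (hf : IsQMultiplicative q f)
    (v : Fin (s + 1) → ℕ) : ‖cubeProd f v‖ = 1 := by
  simp [cubeProd, norm_prod, norm_iterate_conj, hf.norm_eq_one]

theorem natVertex_lt {q s g i : ℕ} (hg : s + 1 ≤ q ^ g) {v : Fin (s + 1) → ℕ}
    (hv : ∀ j, v j < q ^ i) (ω : Fin s → Fin 2) : natVertex v ω < q ^ (i + g) := by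
  calc natVertex v ω ≤ ∑ j, v j := natVertex_le_sum v ω
    _ < ∑ _j : Fin (s + 1), q ^ i := Finset.sum_lt_sum_of_nonempty (by simp) fun j _ => hv j
    _ = q ^ i * (s + 1) := by simp [mul_comm]
    _ ≤ q ^ (i + g) := by rw [pow_add]; gcongr

theorem dvd_natVertex {s c : ℕ} {v : Fin (s + 1) → ℕ} (hv : ∀ j, c ∣ v j)
    (ω : Fin s → Fin 2) : c ∣ natVertex v ω :=
  dvd_add (hv 0) (Finset.dvd_sum fun _ _ => (hv _).mul_left _)

/-- A parallelepiped in a window of digits, separated by zero digits from the parallelepipeds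
below and above it, contributes a factor to the multiplicative derivative. -/
theorem cubeProd_window {q s g k i : ℕ} {f : ℕ → ℂ} (hf : IsQMultiplicative q f)
    (hg : s + 1 ≤ q ^ g) {l w H : Fin (s + 1) → ℕ} (hl : ∀ j, l j < q ^ i)
    (hw : ∑ j, w j < q ^ k) (hH : ∀ j, q ^ (i + (g + k)) ∣ H j) :
    cubeProd f (l + q ^ (i + g) • w + H) = cubeProd f (l + H) * cubeProd f (q ^ (i + g) • w) := by
  rw [cubeProd, cubeProd, cubeProd, ← Finset.prod_mul_distrib]
  refine Finset.prod_congr rfl fun ω _ => ?_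
  rw [← iterate_map_mul]
  congr 1
  simp only [natVertex_add, natVertex_smul]
  have h1 := natVertex_lt hg hl ω
  have h2 := (natVertex_le_sum w ω).trans_lt hw
  have h3 := dvd_natVertex hH ω
  have h4 : natVertex l ω + q ^ (i + g) * natVertex w ω < q ^ (i + (g + k)) := by
    calc _ < q ^ (i + g) * (natVertex w ω + 1) := by linarith
      _ ≤ q ^ (i + g) * q ^ k := by gcongr; omega
      _ = _ := by ring
  rw [hf.map_add _ _ _ h4 h3, hf.map_add _ _ _ h1 (dvd_mul_right _ _),
    hf.map_add (i + g) _ _ h1 ((pow_dvd_pow q (by omega)).trans h3)]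
  ring

/-- The box `[0, N)^{s+1}`. -/
def box (s N : ℕ) : Finset (Fin (s + 1) → ℕ) := Fintype.piFinset fun _ => Finset.range N

theorem mem_box {s N : ℕ} {v : Fin (s + 1) → ℕ} : v ∈ box s N ↔ ∀ j, v j < N := by
  simp [box]

theorem card_box (s N : ℕ) : (box s N).card = N ^ (s + 1) := by
  simp [box]

theorem sum_box_mul {s a b : ℕ} (ha : 0 < a) (F : (Fin (s + 1) → ℕ) → ℂ) :
    ∑ v ∈ box s (a * b), F v = ∑ d ∈ box s b, ∑ l ∈ box s a, F (l + a • d) := by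
  rw [← Finset.sum_product' (f := fun d l => F (l + a • d))]
  refine Finset.sum_bij' (fun v _ => (fun j => v j / a, fun j => v j % a))
    (fun p _ => p.2 + a • p.1) ?_ ?_ ?_ ?_ ?_
  · intro v hv
    rw [mem_box] at hv
    simp only [Finset.mem_product, mem_box]
    exact ⟨fun j => Nat.div_lt_of_lt_mul (hv j), fun j => Nat.mod_lt _ ha⟩
  · rintro ⟨d, l⟩ hp
    simp only [Finset.mem_product, mem_box] at hp
    refine mem_box.2 fun j => ?_
    have h1 := hp.1 j
    have h2 := hp.2 j
    simp only [Pi.add_apply, Pi.smul_apply, smul_eq_mul]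
    calc _ < a * (d j + 1) := by linarith
      _ ≤ a * b := by gcongr; omega
  · intro v _
    ext j
    simp [Nat.mod_add_div]
  · rintro ⟨d, l⟩ hp
    simp only [Finset.mem_product, mem_box] at hp
    refine Prod.ext ?_ ?_ <;> funext j
    · simp [Nat.add_mul_div_left _ _ ha, Nat.div_eq_of_lt (hp.2 j)]
    · simp [Nat.mod_eq_of_lt (hp.2 j)]
  · intro v _
    congr 1
    ext j
    simp [Nat.mod_add_div]

/-! ### Multiplicative losses over disjoint windows. -/

/-- The loss in the Gowers average caused by the parallelepiped `w` placed above digit `i + g`. -/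
noncomputable def loss {s : ℕ} (q g k : ℕ) (w : Fin (s + 1) → ℕ) (f : ℕ → ℂ) (i : ℕ) : ℝ :=
  (2 - ‖1 + cubeProd f (q ^ (i + g) • w)‖) / (q ^ (g + k) : ℝ) ^ (s + 1)

theorem norm_one_add_le {z : ℂ} (hz : ‖z‖ = 1) : ‖1 + z‖ ≤ 2 :=
  (norm_add_le _ _).trans (by norm_num [hz])

/-- By the parallelogram law the left side is `(2 - ‖1 + z‖) * (2 + ‖1 + z‖)`. -/
theorem norm_one_sub_sq_le {z : ℂ} (hz : ‖z‖ = 1) : ‖1 - z‖ ^ 2 ≤ 4 * (2 - ‖1 + z‖) := by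
  have h := parallelogram_law_with_norm ℝ (1 : ℂ) z
  have h2 := norm_one_add_le hz
  rw [hz] at h
  norm_num at h
  nlinarith [norm_nonneg (1 + z)]

/-- Each new window gains one factor from the cancellation between two sub-boxes only. The shift `H`
is arbitrary so that the induction applies to a sub-box with its higher digits frozen. -/
theorem norm_sum_box_le {q s g k r : ℕ} {f : ℕ → ℂ} (hq : 2 ≤ q) (hf : IsQMultiplicative q f)
    (hg : s + 1 ≤ q ^ g) {w : Fin (s + 1) → ℕ} (hw : ∑ j, w j < q ^ k) (hw0 : w ≠ 0) (M : ℕ)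
    (H : Fin (s + 1) → ℕ) (hH : ∀ j, q ^ (r + M * (g + k)) ∣ H j) :
    ‖∑ l ∈ box s (q ^ (r + M * (g + k))), cubeProd f (l + H)‖ ≤
      ((q : ℝ) ^ (r + M * (g + k))) ^ (s + 1) *
        ∏ c ∈ Finset.range M, (1 - loss q g k w f (r + c * (g + k))) := by
  have hq0 : 0 < q := by omega
  induction M generalizing H with
  | zero =>
    refine (norm_sum_le _ _).trans ?_
    simp [norm_cubeProd hf, card_box]
  | succ M ih =>
    set i := r + M * (g + k) with hi
    have hi' : r + (M + 1) * (g + k) = i + (g + k) := by rw [hi]; ring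
    rw [hi'] at hH ⊢
    set P := ∏ c ∈ Finset.range M, (1 - loss q g k w f (r + c * (g + k))) with hP
    set A : ℝ := ((q : ℝ) ^ i) ^ (s + 1) * P with hA
    set B : ℝ := (q ^ (g + k) : ℝ) ^ (s + 1) with hB
    have hB0 : 0 < B := by positivity
    have hdvd : ∀ d : Fin (s + 1) → ℕ, ∀ j, q ^ i ∣ (q ^ i • d + H) j := fun d j =>
      dvd_add (dvd_mul_right _ _) ((pow_dvd_pow q (by omega)).trans (hH j))
    set T : (Fin (s + 1) → ℕ) → ℂ := fun d =>
      ∑ l ∈ box s (q ^ i), cubeProd f (l + q ^ i • d + H) with hT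
    have hTle : ∀ d, ‖T d‖ ≤ A := fun d => by
      have := ih (q ^ i • d + H) (hdvd d)
      simpa only [hT, add_assoc] using this
    have hw' : q ^ g • w ∈ box s (q ^ (g + k)) := mem_box.2 fun j => by
      have := (Finset.single_le_sum (f := w) (fun _ _ => Nat.zero_le _)
        (Finset.mem_univ j)).trans_lt hw
      rw [pow_add, Pi.smul_apply, smul_eq_mul]
      gcongr
    have h0 : (0 : Fin (s + 1) → ℕ) ∈ box s (q ^ (g + k)) := mem_box.2 fun j => by
      simp only [Pi.zero_apply]; positivity
    have hne : (0 : Fin (s + 1) → ℕ) ≠ q ^ g • w := by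
      intro h
      refine hw0 (funext fun j => ?_)
      have := congrFun h j
      simpa [hq0.ne'] using this.symm
    set z := cubeProd f (q ^ (i + g) • w) with hz
    -- The window `w` factors out, so these two sub-boxes together contribute `(1 + z) * T 0`; the
    -- other `B - 2` are bounded trivially.
    have hTw : T (q ^ g • w) = T 0 * z := by
      simp only [hT, Finset.sum_mul]
      refine Finset.sum_congr rfl fun l hl => ?_
      rw [smul_smul, ← pow_add, cubeProd_window hf hg (mem_box.1 hl) hw hH, smul_zero, add_zero]
    have hpair : ‖T 0 + T (q ^ g • w)‖ ≤ ‖1 + z‖ * A := by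
      rw [hTw, show T 0 + T 0 * z = (1 + z) * T 0 by ring, norm_mul]
      gcongr
      exact hTle 0
    have hsub : ({0, q ^ g • w} : Finset (Fin (s + 1) → ℕ)) ⊆ box s (q ^ (g + k)) := by
      intro x hx
      simp only [Finset.mem_insert, Finset.mem_singleton] at hx
      rcases hx with rfl | rfl <;> assumption
    have hcard : (((box s (q ^ (g + k))) \ {0, q ^ g • w}).card : ℝ) = B - 2 := by
      rw [Finset.card_sdiff_of_subset hsub, Nat.cast_sub (Finset.card_le_card hsub),
        Finset.card_pair hne, card_box]
      simp [hB]
    have key : ‖∑ l ∈ box s (q ^ (i + (g + k))), cubeProd f (l + H)‖ ≤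
        (B - 2) * A + ‖1 + z‖ * A := by
      rw [pow_add, sum_box_mul (by positivity), ← Finset.sum_sdiff hsub, Finset.sum_pair hne]
      refine (norm_add_le _ _).trans (add_le_add ?_ hpair)
      refine (norm_sum_le _ _).trans ?_
      rw [← hcard, ← nsmul_eq_mul]
      exact Finset.sum_le_card_nsmul _ _ _ fun d _ => hTle d
    refine key.trans (le_of_eq ?_)
    rw [Finset.prod_range_succ, ← hP, loss, ← hi, ← hz, ← hB, pow_add (q : ℝ) i (g + k), mul_pow, ← hB, hA]
    field_simp
    ring

/-! ### From the Gowers norm to a bound on the losses. -/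

theorem sum_one_sub_re_le {s N : ℕ} {f : ℕ → ℂ} (hs : 1 ≤ s) {ε : ℝ} (hε : ε ≤ 1)
    (h : 1 - ε < gowersNorm s N f) :
    ∑ v ∈ parallelepipeds s N, (1 - (∏ ω : Fin s → Fin 2,
      (starRingEnd ℂ)^[weight ω] (f (vertex v ω).toNat)).re) ≤
        2 ^ s * ε * (parallelepipeds s N).card := by
  rcases Nat.eq_zero_or_pos (parallelepipeds s N).card with h0 | h0
  · rw [Finset.card_eq_zero.1 h0]
    simp
  have h1 : 1 - 2 ^ s * ε ≤ (gowersAverage s N f).re := by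
    rw [← gowersNorm_pow hs, Complex.ofReal_re]
    calc 1 - 2 ^ s * ε = 1 + ((2 ^ s : ℕ) : ℝ) * (-ε) := by push_cast; ring
      _ ≤ (1 + -ε) ^ 2 ^ s := one_add_mul_le_pow (by linarith) _
      _ ≤ _ := by
        apply pow_le_pow_left₀ <;> linarith
  rw [gowersAverage, Complex.div_natCast_re, le_div_iff₀ (by positivity), Complex.re_sum] at h1
  rw [Finset.sum_sub_distrib, Finset.sum_const, nsmul_eq_mul]
  linarith

theorem card_parallelepipeds_le (s N : ℕ) :
    (parallelepipeds s N).card ≤ (2 * N) ^ (s + 1) := by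
  refine (Finset.card_filter_le _ _).trans ?_
  simp only [Fintype.card_piFinset, Int.card_Ioo, Finset.prod_const, Finset.card_univ,
    Fintype.card_fin]
  gcongr
  omega

/-- The summands are nonnegative, so passing from all parallelepipeds to a translated box inside
them can only decrease the sum. -/
theorem sum_box_one_sub_re_le {q s N n : ℕ} {f : ℕ → ℂ} (hf : IsQMultiplicative q f)
    {H : Fin (s + 1) → ℕ}
    (hH : ∀ l ∈ box s n, ∀ ω, natVertex (l + H) ω < N) :
    ∑ l ∈ box s n, (1 - (cubeProd f (l + H)).re) ≤
      ∑ v ∈ parallelepipeds s N, (1 - (∏ ω : Fin s → Fin 2,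
        (starRingEnd ℂ)^[weight ω] (f (vertex v ω).toNat)).re) := by
  classical
  let φ : (Fin (s + 1) → ℕ) → (Fin (s + 1) → ℤ) := fun l j => ((l + H) j : ℕ)
  have hφ : ∀ l ∈ box s n, ∀ l' ∈ box s n, φ l = φ l' → l = l' := by
    intro l _ l' _ h
    funext j
    have := congrFun h j
    simpa [φ] using this
  have hle : ∀ v : Fin (s + 1) → ℤ, 0 ≤ 1 - (∏ ω : Fin s → Fin 2,
        (starRingEnd ℂ)^[weight ω] (f (vertex v ω).toNat)).re := by
    intro v
    rw [sub_nonneg]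
    refine (Complex.re_le_norm _).trans (le_of_eq ?_)
    simp [norm_prod, norm_iterate_conj, hf.norm_eq_one]
  have hcube : ∀ l, cubeProd f (l + H) = ∏ ω : Fin s → Fin 2,
        (starRingEnd ℂ)^[weight ω] (f (vertex (φ l) ω).toNat) := by
    intro l
    simp only [φ, vertex_natCast, Int.toNat_natCast, cubeProd]
  simp only [hcube]
  rw [← Finset.sum_image (f := fun v => (1 - (∏ ω : Fin s → Fin 2,
        (starRingEnd ℂ)^[weight ω] (f (vertex v ω).toNat)).re)) hφ]
  refine Finset.sum_le_sum_of_subset_of_nonneg ?_ fun v _ _ => hle v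
  intro v hv
  obtain ⟨l, hl, rfl⟩ := Finset.mem_image.1 hv
  refine mem_parallelepipeds.2 fun ω => ?_
  simp only [φ, vertex_natCast]
  exact ⟨by positivity, by exact_mod_cast hH l hl ω⟩

/-- With `σ` the sum, the product is at most `exp (-σ) ≤ 1 / (1 + σ)`. -/
theorem sum_le_of_one_sub_le_prod {ι : Type*} {S : Finset ι} {x : ι → ℝ} {δ : ℝ}
    (hx : ∀ i ∈ S, 0 ≤ x i) (hx1 : ∀ i ∈ S, x i ≤ 1) (hδ : δ ≤ 1 / 2)
    (h : 1 - δ ≤ ∏ i ∈ S, (1 - x i)) : ∑ i ∈ S, x i ≤ 2 * δ := by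
  have h1 : ∏ i ∈ S, (1 - x i) ≤ Real.exp (-∑ i ∈ S, x i) := by
    rw [← Finset.sum_neg_distrib, Real.exp_sum]
    exact Finset.prod_le_prod (fun i hi => by linarith [hx1 i hi]) fun i _ =>
      Real.one_sub_le_exp_neg _
  have h2 : Real.exp (-∑ i ∈ S, x i) * (1 + ∑ i ∈ S, x i) ≤ 1 := by
    calc _ ≤ Real.exp (-∑ i ∈ S, x i) * Real.exp (∑ i ∈ S, x i) := by
          gcongr
          linarith [Real.add_one_le_exp (∑ i ∈ S, x i)]
      _ = 1 := by rw [← Real.exp_add]; simp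
  have h0 := Finset.sum_nonneg hx
  set σ := ∑ i ∈ S, x i
  have h3 : (1 - δ) * (1 + σ) ≤ 1 :=
    (mul_le_mul_of_nonneg_right (h.trans h1) (by linarith)).trans h2
  nlinarith

theorem loss_nonneg {q s g k : ℕ} {f : ℕ → ℂ} (hf : IsQMultiplicative q f)
    (w : Fin (s + 1) → ℕ) (i : ℕ) : 0 ≤ loss q g k w f i :=
  div_nonneg (sub_nonneg.2 (norm_one_add_le (norm_cubeProd hf _))) (by positivity)

theorem two_le_pow_card {q s g : ℕ} (k : ℕ) (hq : 2 ≤ q) (hg : s + 1 ≤ q ^ g) (hs : 1 ≤ s) :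
    (2 : ℝ) ≤ ((q : ℝ) ^ (g + k)) ^ (s + 1) := by
  have h1 : 2 ≤ q ^ g * q ^ k := (hg.trans' (by omega)).trans
    (Nat.le_mul_of_pos_right _ (by positivity))
  have h2 : (2 : ℝ) ≤ (q : ℝ) ^ (g + k) := by rw [pow_add]; exact_mod_cast h1
  exact h2.trans (le_self_pow₀ (by linarith) (by omega))

theorem loss_le {q s g k : ℕ} {f : ℕ → ℂ} (hf : IsQMultiplicative q f) (hq : 2 ≤ q)
    (hg : s + 1 ≤ q ^ g) (hs : 1 ≤ s)
    (w : Fin (s + 1) → ℕ) (i : ℕ) :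
    loss q g k w f i ≤ (2 - ‖1 + cubeProd f (q ^ (i + g) • w)‖) / 2 ∧ loss q g k w f i ≤ 1 := by
  have h2 := two_le_pow_card k hq hg hs
  have h3 := norm_nonneg (1 + cubeProd f (q ^ (i + g) • w))
  have h4 : loss q g k w f i ≤ (2 - ‖1 + cubeProd f (q ^ (i + g) • w)‖) / 2 :=
    div_le_div_of_nonneg_left (sub_nonneg.2 (norm_one_add_le (norm_cubeProd hf _)))
      (by norm_num) h2
  exact ⟨h4, by linarith⟩

/-- The losses along an arithmetic progression of windows reaching close to digit `L`. -/
theorem sum_loss_progression_le {q s g k r M L : ℕ} {f : ℕ → ℂ} (hq : 2 ≤ q) (hs : 1 ≤ s)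
    (hf : IsQMultiplicative q f) (hg : s + 1 ≤ q ^ g) {w : Fin (s + 1) → ℕ}
    (hw : ∑ j, w j < q ^ k) (hw0 : w ≠ 0) {ε : ℝ} (hε0 : 0 ≤ ε) (hε1 : ε ≤ 1)
    (hε : 2 * (2 ^ s * (2 * (q : ℝ) ^ (2 * (g + k))) ^ (s + 1)) * ε ≤ 1)
    (hnorm : 1 - ε < gowersNorm s (q ^ L) f) (hML : r + M * (g + k) + (g + k) ≤ L)
    (hLM : L ≤ r + M * (g + k) + 2 * (g + k)) :
    ∑ c ∈ Finset.range (M + 1), loss q g k w f (r + c * (g + k)) ≤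
      2 * (2 ^ s * (2 * (q : ℝ) ^ (2 * (g + k))) ^ (s + 1)) * ε := by
  set C : ℝ := 2 ^ s * (2 * (q : ℝ) ^ (2 * (g + k))) ^ (s + 1) with hC
  rw [mul_assoc]
  refine sum_le_of_one_sub_le_prod (fun i _ => loss_nonneg hf _ _)
    (fun i _ => (loss_le hf hq hg hs _ _).2) (by linarith) ?_
  set i := r + M * (g + k) with hi
  set Q : ℝ := ((q : ℝ) ^ i) ^ (s + 1) with hQ
  have hq0 : 0 < q := by omega
  have hQ0 : 0 < Q := by positivity
  set z := cubeProd f (q ^ (i + g) • w) with hz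
  have hdef := sum_one_sub_re_le hs hε1 hnorm
  have hbound : 2 ^ s * ε * ((parallelepipeds s (q ^ L)).card : ℝ) ≤ C * ε * Q := by
    have h1 : ((parallelepipeds s (q ^ L)).card : ℝ) ≤ (2 * (q : ℝ) ^ L) ^ (s + 1) := by
      exact_mod_cast card_parallelepipeds_le s (q ^ L)
    -- The box has side within a bounded factor of `q ^ L`, hence a proportion of the
    -- parallelepipeds bounded below independently of `L`.
    have h2 : (q : ℝ) ^ L ≤ q ^ (2 * (g + k)) * q ^ i := by
      rw [← pow_add]
      exact pow_le_pow_right₀ (by exact_mod_cast hq0) (by omega)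
    calc 2 ^ s * ε * ((parallelepipeds s (q ^ L)).card : ℝ)
        ≤ 2 ^ s * ε * (2 * (q ^ (2 * (g + k)) * q ^ i)) ^ (s + 1) := by
          gcongr
          exact h1.trans (by gcongr)
      _ = C * ε * Q := by rw [hC, hQ, ← mul_assoc 2, mul_pow _ ((q : ℝ) ^ i)]; ring
  -- The top window is handled apart, through the two translates `u = 0` and `u = w` of one box: a
  -- full box including that window could have vertices beyond `q ^ L`.
  have hlow : ∀ u : Fin (s + 1) → ℕ, ∑ j, u j < q ^ k →
      Q - C * ε * Q ≤ (∑ l ∈ box s (q ^ i), cubeProd f (l + q ^ (i + g) • u)).re := by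
    intro u hu
    have h1 := sum_box_one_sub_re_le (N := q ^ L) (n := q ^ i) (H := q ^ (i + g) • u) hf (by
      intro l hl ω
      rw [natVertex_add, natVertex_smul]
      have h1 := natVertex_lt hg (mem_box.1 hl) ω
      have h2 := (natVertex_le_sum u ω).trans_lt hu
      calc _ < q ^ (i + g) * (natVertex u ω + 1) := by linarith
        _ ≤ q ^ (i + g) * q ^ k := by gcongr; omega
        _ = q ^ (i + (g + k)) := by ring
        _ ≤ q ^ L := Nat.pow_le_pow_right hq0 hML)
    rw [Finset.sum_sub_distrib, Finset.sum_const, nsmul_eq_mul, mul_one, card_box,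
      ← Complex.re_sum] at h1
    push_cast at h1
    linarith
  have h0 := hlow 0 (by simpa using by positivity)
  have h1 := hlow w hw
  simp only [smul_zero, add_zero] at h0
  have hfac : ∑ l ∈ box s (q ^ i), cubeProd f (l + q ^ (i + g) • w) =
      (∑ l ∈ box s (q ^ i), cubeProd f l) * z := by
    rw [Finset.sum_mul]
    refine Finset.sum_congr rfl fun l hl => ?_
    simpa only [add_zero] using cubeProd_window (H := 0) hf hg (mem_box.1 hl) hw (by simp)
  have hup := norm_sum_box_le (r := r) hq hf hg hw hw0 M 0 (by simp)
  simp only [add_zero, ← hi, ← hQ] at hup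
  set P := ∏ c ∈ Finset.range M, (1 - loss q g k w f (r + c * (g + k))) with hP
  have hP0 : 0 ≤ P := Finset.prod_nonneg fun c _ => sub_nonneg.2 (loss_le hf hq hg hs _ _).2
  have h2 : 2 * (Q - C * ε * Q) ≤ ‖1 + z‖ * (Q * P) := by
    calc 2 * (Q - C * ε * Q) ≤ ((∑ l ∈ box s (q ^ i), cubeProd f l) +
          (∑ l ∈ box s (q ^ i), cubeProd f l) * z).re := by
            rw [Complex.add_re, ← hfac]; linarith
      _ ≤ ‖(∑ l ∈ box s (q ^ i), cubeProd f l) +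
          (∑ l ∈ box s (q ^ i), cubeProd f l) * z‖ := Complex.re_le_norm _
      _ = ‖1 + z‖ * ‖∑ l ∈ box s (q ^ i), cubeProd f l‖ := by rw [← norm_mul]; congr 1; ring
      _ ≤ _ := by gcongr
  rw [Finset.prod_range_succ, ← hP, ← hi]
  have h3 : 1 - C * ε ≤ (‖1 + z‖ / 2) * P := by
    refine le_of_mul_le_mul_right ?_ hQ0
    linarith
  refine h3.trans ?_
  rw [mul_comm]
  gcongr
  linarith [(loss_le (k := k) hf hq hg hs w i).1]

/-- Windows at positions congruent modulo `g + k` are disjoint, so the positions are split into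
residue classes, and each class is a progression of windows. -/
theorem sum_norm_one_sub_cubeProd_sq_le {q s : ℕ} (g k : ℕ) (hq : 2 ≤ q) (hs : 1 ≤ s)
    (hg : s + 1 ≤ q ^ g) : ∃ C : ℝ, 0 < C ∧ ∀ f : ℕ → ℂ, IsQMultiplicative q f →
      ∀ w : Fin (s + 1) → ℕ, ∑ j, w j < q ^ k → w ≠ 0 → ∀ (ε : ℝ) (L : ℕ), 0 < ε → ε ≤ 1 →
        C * ε ≤ 1 → 1 - ε < gowersNorm s (q ^ L) f →
          ∑ i ∈ Finset.range (L + 1 - (g + k)), ‖1 - cubeProd f (q ^ (i + g) • w)‖ ^ 2 ≤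
            C * ε := by
  set K := g + k with hK
  have hq0 : (0 : ℝ) < q := by exact_mod_cast (by omega : 0 < q)
  have hq1 : (1 : ℝ) ≤ q := by exact_mod_cast (by omega : 1 ≤ q)
  have hK0 : 0 < K := by
    rcases Nat.eq_zero_or_pos g with h | h
    · subst h; simp at hg; omega
    · omega
  set D : ℝ := 2 * (2 ^ s * (2 * (q : ℝ) ^ (2 * K)) ^ (s + 1)) with hD
  set B : ℝ := ((q : ℝ) ^ K) ^ (s + 1) with hB
  have hD0 : 0 < D := by positivity
  have hB1 : 1 ≤ B := one_le_pow₀ (one_le_pow₀ hq1)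
  refine ⟨4 * B * (K * D), by positivity, ?_⟩
  intro f hf w hw hw0 ε L hε0 hε1 hCε hnorm
  have hDε : D * ε ≤ 1 := by
    refine le_trans ?_ hCε
    have : (1 : ℝ) ≤ K := by exact_mod_cast hK0
    have h4 : 1 ≤ 4 * B * K := by nlinarith
    calc D * ε = 1 * (D * ε) := by ring
      _ ≤ (4 * B * K) * (D * ε) := by gcongr
      _ = _ := by ring
  have hloss : ∀ i, ‖1 - cubeProd f (q ^ (i + g) • w)‖ ^ 2 ≤ 4 * B * loss q g k w f i := by
    intro i
    refine (norm_one_sub_sq_le (norm_cubeProd hf _)).trans (le_of_eq ?_)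
    rw [loss, ← hK, ← hB]
    field_simp
  refine (Finset.sum_le_sum fun i _ => hloss i).trans ?_
  rw [← Finset.mul_sum, mul_assoc (4 * B)]
  gcongr
  set n := L + 1 - K with hn
  rw [← Finset.sum_fiberwise_of_maps_to (s := Finset.range n) (t := Finset.range K)
    (g := fun i => i % K) (fun i _ => Finset.mem_range.2 (Nat.mod_lt _ hK0))]
  have : ∀ r ∈ Finset.range K, ∑ i ∈ Finset.range n with i % K = r, loss q g k w f i ≤ D * ε := by
    intro r hr
    rcases lt_or_ge r n with hrn | hrn
    -- The last position in the class of `r`: its window ends at most at digit `L`, and no further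
    -- window fits.
    · set M := (n - 1 - r) / K with hM
      have h1 : M * K ≤ n - 1 - r := Nat.div_mul_le_self _ _
      have h2 : n - 1 - r < M * K + K := Nat.lt_div_mul_add hK0
      refine le_trans ?_ (sum_loss_progression_le (r := r) (M := M) (L := L) hq hs hf hg hw hw0
        hε0.le hε1 hDε hnorm (by rw [← hK]; omega) (by rw [← hK]; omega))
      rw [← Finset.sum_image (s := Finset.range (M + 1)) (g := fun c => r + c * K)
        (f := fun i => loss q g k w f i) (by
          intro a _ b _ h
          simpa [hK0.ne'] using h)]
      refine Finset.sum_le_sum_of_subset_of_nonneg ?_ fun i _ _ => loss_nonneg hf _ _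
      intro i hi
      simp only [Finset.mem_filter, Finset.mem_range] at hi
      refine Finset.mem_image.2 ⟨i / K, ?_, ?_⟩
      · rw [Finset.mem_range, Nat.lt_succ_iff, hM, Nat.le_div_iff_mul_le hK0]
        have := Nat.mod_add_div' i K
        omega
      · rw [← hi.2, Nat.mod_add_div']
    · rw [Finset.sum_eq_zero]
      · positivity
      · intro i hi
        simp only [Finset.mem_filter, Finset.mem_range] at hi
        have := Nat.mod_le i K
        omega
  refine (Finset.sum_le_card_nsmul _ _ _ this).trans (le_of_eq ?_)
  simp [mul_assoc]

/-! ### Second differences detected by parallelepipeds. -/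

theorem prod_iterate_conj_weight {s : ℕ} (hs : 1 ≤ s) {A : ℂ} (hA : ‖A‖ = 1) :
    ∏ ω : Fin s → Fin 2, (starRingEnd ℂ)^[weight ω] A = 1 := by
  obtain ⟨t, rfl⟩ : ∃ t, s = t + 1 := ⟨s - 1, by omega⟩
  rw [prod_cube_succ, ← Finset.prod_mul_distrib]
  refine Finset.prod_eq_one fun ω _ => ?_
  simp only [weight_cons, Fin.val_zero, Fin.val_one, zero_add, add_comm 1,
    Function.iterate_succ_apply']
  rw [Complex.mul_conj, Complex.normSq_eq_norm_sq, norm_iterate_conj, hA]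
  simp

/-- A composition of `n` with `s` positive parts. -/
theorem exists_pos_sum_eq {s n : ℕ} (hs : 1 ≤ s) (hn : s ≤ n) :
    ∃ h : Fin s → ℕ, (∀ i, 1 ≤ h i) ∧ ∑ i, h i = n := by
  obtain ⟨t, rfl⟩ : ∃ t, s = t + 1 := ⟨s - 1, by omega⟩
  refine ⟨Fin.cons (n - t) fun _ => 1, fun i => ?_, ?_⟩
  · refine Fin.cases ?_ (fun j => ?_) i
    · simp only [Fin.cons_zero]; omega
    · simp
  · rw [Fin.sum_univ_succ]
    simp only [Fin.cons_zero, Fin.cons_succ, Finset.sum_const, Finset.card_univ, Fintype.card_fin,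
      smul_eq_mul, mul_one]
    omega

/-- The parallelepiped that detects the second difference of `a ↦ f (a Q)` at `a`. -/
theorem exists_cubeProd_second_difference {q s t a : ℕ} (hs : 2 ≤ s) (ht : s ≤ q ^ t)
    (ha1 : 1 ≤ a) (haq : a + 1 ≤ q) :
    ∃ w : Fin (s + 1) → ℕ, w ≠ 0 ∧ ∑ j, w j = (a + 1) * q ^ t ∧
      ∀ f : ℕ → ℂ, IsQMultiplicative q f → ∀ m : ℕ,
        ‖1 - cubeProd f (q ^ m • w)‖ =
          ‖f ((a + 1) * q ^ (m + t)) * f ((a - 1) * q ^ (m + t)) - f (a * q ^ (m + t)) ^ 2‖ := by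
  obtain ⟨u, rfl⟩ : ∃ u, s = u + 1 := ⟨s - 1, by omega⟩
  obtain ⟨b, rfl⟩ : ∃ b, a = b + 1 := ⟨a - 1, by omega⟩
  obtain ⟨h, hpos, hsum⟩ := exists_pos_sum_eq (s := u) (n := q ^ t) (by omega) (by omega)
  have hu : 1 ≤ u := by omega
  -- The edges `h` are positive with sum `q ^ t`, so among their subset sums only the full one
  -- carries into digit `t`.
  refine ⟨Fin.cons (b * q ^ t) (Fin.cons (q ^ t) h), ?_, ?_, ?_⟩
  · intro h0
    have := congrFun h0 1
    have h1 : (Fin.cons (b * q ^ t) (Fin.cons (q ^ t) h) : Fin (u + 1 + 1) → ℕ) 1 = q ^ t := rfl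
    rw [h1, Pi.zero_apply] at this
    omega
  · rw [Fin.sum_univ_succ, Fin.sum_univ_succ]
    simp only [Fin.cons_zero, Fin.cons_succ, hsum]
    ring
  intro f hf m
  simp only [Nat.add_sub_cancel]
  set Q := q ^ (m + t) with hQ
  set A : ℂ := f (b * Q) * (starRingEnd ℂ) (f ((b + 1) * Q)) with hA
  set B : ℂ := f ((b + 1) * Q) * (starRingEnd ℂ) (f ((b + 1 + 1) * Q)) with hB
  have hunit : ∀ n, f n * (starRingEnd ℂ) (f n) = 1 := fun n => by
    rw [Complex.mul_conj, Complex.normSq_eq_norm_sq, hf.norm_eq_one]; simp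
  have hA1 : ‖A‖ = 1 := by simp [hA, hf.norm_eq_one]
  have hAA : A * (starRingEnd ℂ) A = 1 := by
    rw [Complex.mul_conj, Complex.normSq_eq_norm_sq, hA1]; simp
  let top : Fin u → Fin 2 := fun _ => 1
  -- Pair the vertices along the edge `q ^ t`. Without a carry the low digits cancel and leave the
  -- ratio `A`; the full sum gives the next ratio `B`.
  have hterm : ∀ ω : Fin u → Fin 2,
      f (q ^ m * (b * q ^ t + ∑ i, (ω i : ℕ) * h i)) *
        (starRingEnd ℂ) (f (q ^ m * (b * q ^ t + q ^ t + ∑ i, (ω i : ℕ) * h i))) =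
      A * (if ω = top then B * (starRingEnd ℂ) A else 1) := by
    intro ω
    split_ifs with hω
    · have : ∑ i, (ω i : ℕ) * h i = q ^ t := by rw [hω]; simp [top, hsum]
      rw [this, show A * (B * (starRingEnd ℂ) A) = B * (A * (starRingEnd ℂ) A) by ring, hAA,
        mul_one, hB, show q ^ m * (b * q ^ t + q ^ t) = (b + 1) * Q by rw [hQ]; ring,
        show q ^ m * (b * q ^ t + q ^ t + q ^ t) = (b + 1 + 1) * Q by rw [hQ]; ring]
    · obtain ⟨i, hi⟩ : ∃ i, ω i ≠ 1 := by
        by_contra! hcon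
        exact hω (funext hcon)
      have hi0 : ω i = 0 := by omega
      have hlt : ∑ i, (ω i : ℕ) * h i < q ^ t := by
        rw [← hsum]
        refine Finset.sum_lt_sum (fun j _ => ?_) ⟨i, Finset.mem_univ _, ?_⟩
        · have : (ω j : ℕ) ≤ 1 := by omega
          nlinarith
        · simp only [hi0, Fin.val_zero, zero_mul]
          exact hpos i
      set x := ∑ i, (ω i : ℕ) * h i
      have hx : q ^ m * x < q ^ (m + t) := by
        rw [pow_add]
        have : 0 < q := by omega
        gcongr
      rw [show q ^ m * (b * q ^ t + x) = q ^ m * x + b * Q by rw [hQ]; ring,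
        show q ^ m * (b * q ^ t + q ^ t + x) = q ^ m * x + (b + 1) * Q by rw [hQ]; ring,
        hf.map_add _ _ _ hx (dvd_mul_left _ _), hf.map_add _ _ _ hx (dvd_mul_left _ _), map_mul,
        mul_one, hA]
      linear_combination (f (b * Q) * (starRingEnd ℂ) (f ((b + 1) * Q))) * hunit (q ^ m * x)
  have hcube : cubeProd f (q ^ m • (Fin.cons (b * q ^ t) (Fin.cons (q ^ t) h) :
      Fin (u + 1 + 1) → ℕ)) = (starRingEnd ℂ)^[weight top] (B * (starRingEnd ℂ) A) := by
    rw [cubeProd, prod_cube_succ, ← Finset.prod_mul_distrib]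
    have : ∀ ω : Fin u → Fin 2, (starRingEnd ℂ)^[weight (Fin.cons 0 ω : Fin (u + 1) → Fin 2)]
          (f (natVertex (q ^ m • (Fin.cons (b * q ^ t) (Fin.cons (q ^ t) h) :
            Fin (u + 1 + 1) → ℕ)) (Fin.cons 0 ω))) *
        (starRingEnd ℂ)^[weight (Fin.cons 1 ω : Fin (u + 1) → Fin 2)]
          (f (natVertex (q ^ m • (Fin.cons (b * q ^ t) (Fin.cons (q ^ t) h) :
            Fin (u + 1 + 1) → ℕ)) (Fin.cons 1 ω))) =
        (starRingEnd ℂ)^[weight ω] A *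
          (if ω = top then (starRingEnd ℂ)^[weight top] (B * (starRingEnd ℂ) A) else 1) := by
      intro ω
      have h1 := congrArg (starRingEnd ℂ)^[weight ω] (hterm ω)
      rw [iterate_map_mul, iterate_map_mul] at h1
      simp only [weight_cons, natVertex_smul, natVertex_cons, Fin.val_zero, Fin.val_one, zero_add,
        zero_mul, add_zero, one_mul, add_comm 1, Function.iterate_succ_apply]
      rw [h1]
      split_ifs with hω
      · rw [hω]
      · rw [iterate_map_one]
    -- The conjugated copies of `A` cancel over the cube because `u ≥ 1`; this is where `s ≥ 2`
    -- enters.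
    rw [Finset.prod_congr rfl fun ω _ => this ω, Finset.prod_mul_distrib,
      prod_iterate_conj_weight hu hA1]
    simp
  rw [hcube, ← iterate_map_one (starRingEnd ℂ) (weight top), ← iterate_map_sub, norm_iterate_conj]
  have h1 : (1 - B * (starRingEnd ℂ) A) * (f (b * Q) * f ((b + 1 + 1) * Q)) =
      f ((b + 1 + 1) * Q) * f (b * Q) - f ((b + 1) * Q) ^ 2 := by
    rw [hB, hA, map_mul, Complex.conj_conj]
    linear_combination (-(f ((b + 1) * Q) ^ 2) * f (b * Q) * (starRingEnd ℂ) (f (b * Q))) *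
      hunit ((b + 1 + 1) * Q) - f ((b + 1) * Q) ^ 2 * hunit (b * Q)
  rw [← h1, norm_mul]
  simp [hf.norm_eq_one]

/-- The second difference of `a ↦ f (a q ^ j)` at `a`. -/
noncomputable def secondDiff (q : ℕ) (f : ℕ → ℂ) (j a : ℕ) : ℝ :=
  ‖f ((a + 1) * q ^ j) * f ((a - 1) * q ^ j) - f (a * q ^ j) ^ 2‖

theorem sum_secondDiff_sq_le {q s : ℕ} (hq : 2 ≤ q) (hs : 2 ≤ s) {a : ℕ} (ha1 : 1 ≤ a) {k : ℕ}
    (hk : (a + 1) * q ^ s < q ^ k) (haq : a + 1 ≤ q) :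
    ∃ C : ℝ, 0 < C ∧ ∀ f : ℕ → ℂ, IsQMultiplicative q f → ∀ (ε : ℝ) (L : ℕ), 0 < ε → ε ≤ 1 →
      C * ε ≤ 1 → 1 - ε < gowersNorm s (q ^ L) f →
        ∑ i ∈ Finset.range (L + 1 - (s + 1 + k)), secondDiff q f (2 * s + 1 + i) a ^ 2 ≤
          C * ε := by
  have hpow : ∀ n, n < q ^ n := fun n => Nat.lt_pow_self (by omega)
  -- There are `s + 1` guard digits, and `w` itself spends `t = s` low digits: together they give
  -- the offset `2 * s + 1`.
  obtain ⟨C, hC0, hC⟩ := sum_norm_one_sub_cubeProd_sq_le (s + 1) k hq (by omega : 1 ≤ s)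
    (hpow (s + 1)).le
  obtain ⟨w, hw0, hw, hwf⟩ := exists_cubeProd_second_difference hs (hpow s).le ha1 haq
  refine ⟨C, hC0, fun f hf ε L hε0 hε1 hCε hn => ?_⟩
  refine le_trans (le_of_eq ?_) (hC f hf w (by rw [hw]; exact hk) hw0 ε L hε0 hε1 hCε hn)
  refine Finset.sum_congr rfl fun i _ => ?_
  rw [hwf f hf, secondDiff, show i + (s + 1) + s = 2 * s + 1 + i by ring]

theorem sum_secondDiff_finset_le {q s : ℕ} (hq : 2 ≤ q) (hs : 2 ≤ s) (S : Finset ℕ) (k : ℕ)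
    (hS : ∀ a ∈ S, 1 ≤ a ∧ (a + 1) * q ^ s < q ^ k ∧ a + 1 ≤ q) :
    ∃ C : ℝ, 0 < C ∧ ∀ f : ℕ → ℂ, IsQMultiplicative q f → ∀ (ε : ℝ) (L : ℕ), 0 < ε → ε ≤ 1 →
      C * ε ≤ 1 → 1 - ε < gowersNorm s (q ^ L) f →
        ∑ i ∈ Finset.range (L + 1 - (s + 1 + k)), ∑ a ∈ S, secondDiff q f (2 * s + 1 + i) a ^ 2 ≤
          C * ε := by
  choose! C hC0 hC using fun a (ha : a ∈ S) =>
    sum_secondDiff_sq_le hq hs (hS a ha).1 (hS a ha).2.1 (hS a ha).2.2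
  have hsum : 0 ≤ ∑ a ∈ S, C a := Finset.sum_nonneg fun a ha => (hC0 a ha).le
  refine ⟨1 + ∑ a ∈ S, C a, by linarith, fun f hf ε L hε0 hε1 hCε hn => ?_⟩
  rw [Finset.sum_comm]
  calc _ ≤ ∑ a ∈ S, C a * ε := by
        refine Finset.sum_le_sum fun a ha => hC a ha f hf ε L hε0 hε1 (hCε.trans' ?_) hn
        have := Finset.single_le_sum (f := C) (fun a ha => (hC0 a ha).le) ha
        gcongr
        linarith
    _ ≤ _ := by rw [← Finset.sum_mul]; gcongr; linarith

/-! ### From second differences to a common frequency. -/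

/-- Telescoping twice: second differences control how far the ratio of consecutive values drifts
from `g (q ^ j)`, and these drifts add up over `a` steps. -/
theorem norm_map_mul_sub_pow_le {q : ℕ} {g : ℕ → ℂ} (hg : ∀ n, ‖g n‖ = 1) (hg0 : g 0 = 1)
    (j a : ℕ) : ‖g (a * q ^ j) - g (q ^ j) ^ a‖ ≤
      a * ∑ b ∈ Finset.Ico 1 a, secondDiff q g j b := by
  set Q := q ^ j with hQ
  have h1 : ∀ b, ‖g ((b + 1) * Q) - g Q * g (b * Q)‖ ≤
      ∑ c ∈ Finset.Ico 1 (b + 1), secondDiff q g j c := by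
    intro b
    induction b with
    | zero => simp [hg0]
    | succ b ih =>
      rw [Finset.sum_Ico_succ_top (by omega)]
      calc ‖g ((b + 1 + 1) * Q) - g Q * g ((b + 1) * Q)‖
          = ‖(g ((b + 1 + 1) * Q) - g Q * g ((b + 1) * Q)) * g (b * Q)‖ := by
            rw [norm_mul, hg, mul_one]
        _ = ‖g ((b + 1) * Q) * (g ((b + 1) * Q) - g Q * g (b * Q)) +
            (g ((b + 1 + 1) * Q) * g (b * Q) - g ((b + 1) * Q) ^ 2)‖ := by congr 1; ring
        _ ≤ _ := by
          refine (norm_add_le _ _).trans ?_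
          rw [norm_mul, hg, one_mul]
          exact add_le_add ih (by simp [secondDiff, hQ])
  have h2 : ∀ b ≤ a, ‖g (b * Q) - g Q ^ b‖ ≤ b * ∑ c ∈ Finset.Ico 1 a, secondDiff q g j c := by
    intro b
    induction b with
    | zero => simp [hg0]
    | succ b ih =>
      intro hb
      calc ‖g ((b + 1) * Q) - g Q ^ (b + 1)‖
          = ‖(g ((b + 1) * Q) - g Q * g (b * Q)) + g Q * (g (b * Q) - g Q ^ b)‖ := by
            congr 1; ring
        _ ≤ (∑ c ∈ Finset.Ico 1 a, secondDiff q g j c) +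
            b * ∑ c ∈ Finset.Ico 1 a, secondDiff q g j c := by
          refine (norm_add_le _ _).trans (add_le_add ((h1 b).trans ?_) ?_)
          · exact Finset.sum_le_sum_of_subset_of_nonneg (Finset.Ico_subset_Ico_right hb)
              fun _ _ _ => norm_nonneg _
          · rw [norm_mul, hg, one_mul]
            exact ih (by omega)
        _ = _ := by push_cast; ring
  exact h2 a le_rfl

theorem e_add (x y : ℝ) : e (x + y) = e x * e y := by
  rw [e, e, e, ← Complex.exp_add]
  push_cast
  ring_nf

theorem e_zero : e 0 = 1 := by simp [e]

theorem e_natCast_mul (n : ℕ) (x : ℝ) : e (n * x) = e x ^ n := by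
  rw [e, e, ← Complex.exp_nat_mul]
  push_cast
  ring_nf

theorem exists_e_eq {z : ℂ} (hz : ‖z‖ = 1) : ∃ x : ℝ, |x| ≤ ‖z - 1‖ ∧ e x = z := by
  refine ⟨z.arg / (2 * Real.pi), ?_, ?_⟩
  · have h := (Complex.norm_sub_mem_Icc_angle hz (by simp : ‖(1 : ℂ)‖ = 1)).1
    rw [Complex.angle_one_right (norm_ne_zero_iff.1 (by rw [hz]; norm_num))] at h
    have hpi := Real.pi_gt_three
    have hpi' := Real.pi_lt_four
    rw [abs_div, abs_of_pos (by positivity : 0 < 2 * Real.pi), div_le_iff₀ (by positivity)]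
    have h2 : |z.arg| ≤ ‖z - 1‖ * (Real.pi / 2) := by
      rw [div_mul_eq_mul_div, div_le_iff₀ (by positivity)] at h
      linarith
    nlinarith [norm_nonneg (z - 1)]
  · conv_rhs => rw [← Complex.norm_mul_exp_arg_mul_I z, hz]
    rw [e]
    push_cast
    rw [one_mul]
    congr 1
    have : (Real.pi : ℂ) ≠ 0 := by exact_mod_cast Real.pi_ne_zero
    field_simp

theorem exists_e_mul_eq {z w : ℂ} (hz : ‖z‖ = 1) (hw : ‖w‖ = 1) :
    ∃ x : ℝ, |x| ≤ ‖z - w‖ ∧ z = w * e x := by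
  have hw0 : w ≠ 0 := norm_ne_zero_iff.1 (by rw [hw]; norm_num)
  obtain ⟨x, hx, hxe⟩ := exists_e_eq (z := z / w) (by rw [norm_div, hz, hw, div_one])
  refine ⟨x, hx.trans (le_of_eq ?_), ?_⟩
  · rw [div_sub_one hw0, norm_div, hw, div_one]
  · rw [hxe]; field_simp

/-- Solving `q y_j = y_{j+1} + κ_j` from the top is a contraction in `ℓ²`. -/
theorem exists_backward_recursion {q : ℝ} (hq : 2 ≤ q) (n : ℕ) (κ : ℕ → ℝ) :
    ∃ y : ℕ → ℝ, (∀ j < n, q * y j = y (j + 1) + κ j) ∧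
      y 0 ^ 2 + ∑ j ∈ Finset.range (n + 1), y j ^ 2 ≤ ∑ j ∈ Finset.range n, κ j ^ 2 := by
  induction n generalizing κ with
  | zero => exact ⟨0, by simp, by simp⟩
  | succ n ih =>
    obtain ⟨y, hy, hsum⟩ := ih fun j => κ (j + 1)
    refine ⟨fun j => Nat.casesOn j ((y 0 + κ 0) / q) y, ?_, ?_⟩
    · rintro (_ | j) hj
      · change q * ((y 0 + κ 0) / q) = y 0 + κ 0
        field_simp
      · exact hy j (by omega)
    · rw [Finset.sum_range_succ', Finset.sum_range_succ' (fun j => κ j ^ 2)]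
      change ((y 0 + κ 0) / q) ^ 2 +
        (∑ j ∈ Finset.range (n + 1), y j ^ 2 + ((y 0 + κ 0) / q) ^ 2) ≤ _
      -- Twice this square is at most `y 0 ^ 2 + κ 0 ^ 2` since `q ≥ 2`; the extra `y 0 ^ 2` in the
      -- invariant pays for the first term.
      have h1 : ((y 0 + κ 0) / q) ^ 2 ≤ (y 0 ^ 2 + κ 0 ^ 2) / 2 := by
        rw [div_pow, div_le_iff₀ (by positivity)]
        nlinarith [sq_nonneg (y 0 - κ 0), mul_nonneg (add_nonneg (sq_nonneg (y 0))
          (sq_nonneg (κ 0))) (by nlinarith : 0 ≤ q ^ 2 - 4)]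
      linarith

/-- Approximate relations between the values at the multiples of powers of `q` give a common
frequency. -/
theorem exists_common_frequency {q : ℕ} (hq : 2 ≤ q) {g : ℕ → ℂ} (hg : ∀ n, ‖g n‖ = 1) (M : ℕ)
    (c d : ℕ → ℝ) (hc : ∀ j < M, ∀ a < q, ‖g (a * q ^ j) - g (q ^ j) ^ a‖ ≤ c j)
    (hd : ∀ j < M - 1, ‖g (q ^ (j + 1)) - g (q ^ j) ^ q‖ ≤ d j) :
    ∃ (α : ℝ) (y : ℕ → ℝ), ∑ j ∈ Finset.range M, y j ^ 2 ≤ ∑ j ∈ Finset.range (M - 1), d j ^ 2 ∧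
      ∀ j < M, ∀ a < q, ∃ ζ : ℝ, |ζ| ≤ c j + q * |y j| ∧
        g (a * q ^ j) = e ((a * q ^ j : ℕ) * α + ζ) := by
  rcases M with _ | n
  · exact ⟨0, 0, by simp, by simp⟩
  simp only [Nat.add_sub_cancel] at *
  choose x hx hxe using fun j => exists_e_mul_eq (hg (q ^ (j + 1)))
    (by rw [norm_pow, hg, one_pow] : ‖g (q ^ j) ^ q‖ = 1)
  choose θ _ hθ using fun j => exists_e_eq (hg (q ^ j))
  obtain ⟨y, hy, hsum⟩ := exists_backward_recursion (q := q) (by exact_mod_cast hq) n x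
  -- The recursion says that raising the identity at `j` to the power `q` gives the identity at `j +
  -- 1`. Solving from the top divides errors by `q` instead of multiplying them.
  have hpow : ∀ j < n + 1, e ((q ^ j : ℕ) * (θ 0 + y 0)) = g (q ^ j) * e (y j) := by
    intro j
    induction j with
    | zero =>
      intro _
      rw [pow_zero, Nat.cast_one, one_mul, e_add, hθ, pow_zero]
    | succ j ih =>
      intro hj
      have h1 := ih (by omega)
      rw [pow_succ' q j, Nat.cast_mul, mul_assoc, e_natCast_mul, h1, mul_pow, ← e_natCast_mul,
        hy j (by omega), e_add, ← pow_succ', hxe j]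
      ring
  refine ⟨θ 0 + y 0, y, ?_, ?_⟩
  · refine le_trans (by linarith [sq_nonneg (y 0)]) (hsum.trans ?_)
    refine Finset.sum_le_sum fun j hj => ?_
    rw [← sq_abs]
    gcongr
    exact (hx j).trans (hd j (Finset.mem_range.1 hj))
  · intro j hj a ha
    obtain ⟨τ, hτ, hτe⟩ := exists_e_mul_eq (hg (a * q ^ j))
      (by rw [norm_pow, hg, one_pow] : ‖g (q ^ j) ^ a‖ = 1)
    refine ⟨τ - a * y j, ?_, ?_⟩
    · refine (abs_sub _ _).trans (add_le_add (hτ.trans (hc j hj a ha)) ?_)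
      rw [abs_mul, Nat.abs_cast]
      gcongr
    · rw [e_add, Nat.cast_mul, mul_assoc, e_natCast_mul, hpow j hj, hτe, mul_pow,
        ← e_natCast_mul]
      have h1 : e τ = e (a * y j) * e (τ - a * y j) := by rw [← e_add]; congr 1; ring
      rw [h1]
      ring

/-! ### Variance of the phase and Chebyshev's inequality. -/

theorem sum_range_mul {A : Type*} [AddCommMonoid A] (N k : ℕ) (F : ℕ → A) :
    ∑ n ∈ Finset.range (N * k), F n =
      ∑ a ∈ Finset.range k, ∑ m ∈ Finset.range N, F (m + a * N) := by
  induction k with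
  | zero => simp
  | succ k ih =>
    rw [Nat.mul_succ, Finset.sum_range_add, ih, Finset.sum_range_succ]
    congr 1
    exact Finset.sum_congr rfl fun m _ => by congr 1; ring

/-- The phase of a `q`-multiplicative sequence is a sum of independent contributions of the
digits, and its variance is bounded by the sum of their second moments. -/
theorem exists_phase_variance_le {q : ℕ} (hq : 2 ≤ q) {g : ℕ → ℂ} (hg : IsQMultiplicative q g)
    (α : ℝ) (c : ℕ → ℝ) (M : ℕ)
    (hc : ∀ j < M, ∀ a < q, ∃ ζ : ℝ, |ζ| ≤ c j ∧ g (a * q ^ j) = e ((a * q ^ j : ℕ) * α + ζ)) :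
    ∃ (β : ℝ) (Z : ℕ → ℝ), (∀ n < q ^ M, g n = e (n * α + β + Z n)) ∧
      ∑ n ∈ Finset.range (q ^ M), Z n = 0 ∧
      ∑ n ∈ Finset.range (q ^ M), Z n ^ 2 ≤ q ^ M * ∑ j ∈ Finset.range M, c j ^ 2 := by
  have hq0 : (0 : ℝ) < q := by exact_mod_cast (by omega : 0 < q)
  induction M with
  | zero =>
    refine ⟨0, 0, ?_, by simp, by simp⟩
    intro n hn
    obtain rfl : n = 0 := by simpa using hn
    simp [hg.map_zero, e_zero]
  | succ M ih =>
    obtain ⟨β, Z, hZ, hZ0, hZ2⟩ := ih fun j hj => hc j (by omega)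
    choose! ζ hζ hζe using hc M (by omega)
    -- The mean contribution of the top digit goes into `β`; the remainder has mean zero, so cross
    -- terms vanish and variances add.
    set μ : ℝ := (∑ a ∈ Finset.range q, ζ a) / q with hμ
    have hN : 0 < q ^ M := by positivity
    have hξ0 : ∑ a ∈ Finset.range q, (ζ a - μ) = 0 := by
      rw [Finset.sum_sub_distrib, Finset.sum_const, Finset.card_range, nsmul_eq_mul, hμ]
      field_simp
      ring
    have hξ2 : ∑ a ∈ Finset.range q, (ζ a - μ) ^ 2 ≤ q * c M ^ 2 := by
      have h1 : ∑ a ∈ Finset.range q, (ζ a - μ) ^ 2 =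
          ∑ a ∈ Finset.range q, ζ a ^ 2 - q * μ ^ 2 := by
        have h2 : ∑ a ∈ Finset.range q, ζ a = q * μ := by rw [hμ]; field_simp
        simp only [sub_sq, Finset.sum_add_distrib, Finset.sum_sub_distrib, ← Finset.sum_mul,
          ← Finset.mul_sum, h2, Finset.sum_const, Finset.card_range, nsmul_eq_mul]
        ring
      have h3 : ∑ a ∈ Finset.range q, ζ a ^ 2 ≤ q * c M ^ 2 := by
        refine (Finset.sum_le_card_nsmul _ _ (c M ^ 2) fun a ha => ?_).trans (by simp)
        rw [← sq_abs]
        gcongr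
        exact hζ a (Finset.mem_range.1 ha)
      rw [h1]
      nlinarith [sq_nonneg μ]
    have hZ' : ∀ a, ∀ m ∈ Finset.range (q ^ M),
        Z ((m + a * q ^ M) % q ^ M) + (ζ ((m + a * q ^ M) / q ^ M) - μ) = Z m + (ζ a - μ) := by
      intro a m hm
      have hm' := Finset.mem_range.1 hm
      rw [Nat.add_mul_mod_self_right, Nat.mod_eq_of_lt hm', Nat.add_mul_div_right _ _ hN,
        Nat.div_eq_of_lt hm', zero_add]
    refine ⟨β + μ, fun n => Z (n % q ^ M) + (ζ (n / q ^ M) - μ), ?_, ?_, ?_⟩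
    · intro n hn
      have h1 : n % q ^ M < q ^ M := Nat.mod_lt _ hN
      have h2 : n / q ^ M < q := Nat.div_lt_of_lt_mul (by rwa [← pow_succ])
      have h3 : n = n % q ^ M + n / q ^ M * q ^ M := (Nat.mod_add_div' _ _).symm
      have h4 : (n : ℝ) = (n % q ^ M : ℕ) + (n / q ^ M * q ^ M : ℕ) := by exact_mod_cast h3
      conv_lhs => rw [h3]
      rw [hg.map_add M _ _ h1 (dvd_mul_left _ _), hZ _ h1, hζe _ h2, ← e_add, h4]
      congr 1
      ring
    · rw [pow_succ, sum_range_mul, Finset.sum_congr rfl fun a _ => Finset.sum_congr rfl (hZ' a)]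
      simp only [Finset.sum_add_distrib, hZ0, Finset.sum_const, ← Finset.smul_sum, hξ0]
      simp
    · rw [pow_succ, sum_range_mul, Finset.sum_congr rfl fun a _ => Finset.sum_congr rfl
        fun m hm => congrArg (· ^ 2) (hZ' a m hm)]
      simp only [add_sq, Finset.sum_add_distrib, ← Finset.sum_mul, ← Finset.mul_sum, hZ0,
        Finset.sum_const, Finset.card_range, nsmul_eq_mul, Nat.cast_pow]
      rw [Finset.sum_range_succ, pow_succ]
      have h5 := mul_le_mul_of_nonneg_left hξ2 (by positivity : (0 : ℝ) ≤ q ^ M)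
      have h6 := mul_le_mul_of_nonneg_left hZ2 hq0.le
      linarith

theorem card_filter_lt_abs_mul_le {ι : Type*} (S : Finset ι) (Z : ι → ℝ) {t : ℝ} (ht : 0 ≤ t) :
    ((S.filter fun n => t < |Z n|).card : ℝ) * t ^ 2 ≤ ∑ n ∈ S, Z n ^ 2 := by
  calc ((S.filter fun n => t < |Z n|).card : ℝ) * t ^ 2
      ≤ ∑ n ∈ S.filter fun n => t < |Z n|, Z n ^ 2 := by
        rw [← nsmul_eq_mul]
        refine Finset.card_nsmul_le_sum _ _ _ fun n hn => ?_
        rw [← sq_abs (Z n)]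
        have := (Finset.mem_filter.1 hn).2
        gcongr
    _ ≤ _ := Finset.sum_le_sum_of_subset_of_nonneg (Finset.filter_subset _ _)
      fun _ _ _ => sq_nonneg _

/-- The restriction of a `q`-multiplicative sequence to the multiples of `q ^ l`. -/
theorem IsQMultiplicative.comp_mul {q : ℕ} {f : ℕ → ℂ} (hq : 2 ≤ q) (hf : IsQMultiplicative q f)
    (l : ℕ) : IsQMultiplicative q fun n => f (q ^ l * n) where
  norm_eq_one _ := hf.norm_eq_one _
  map_add t m n hm hn := by
    have : 0 < q := by omega
    simp only [mul_add]
    refine hf.map_add (l + t) _ _ ?_ ?_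
    · rw [pow_add]; gcongr
    · rw [pow_add]; gcongr

theorem sum_mul_sum_sq_le {q N : ℕ} (S : Finset ℕ) (hS : S.card ≤ q) (F : ℕ → ℕ → ℝ) {δ : ℝ}
    (h : ∑ i ∈ Finset.range N, ∑ a ∈ S, F i a ^ 2 ≤ δ) :
    ∑ i ∈ Finset.range N, (q * ∑ a ∈ S, F i a) ^ 2 ≤ (q : ℝ) ^ 3 * δ := by
  refine le_trans ?_ (mul_le_mul_of_nonneg_left h (by positivity))
  rw [Finset.mul_sum]
  refine Finset.sum_le_sum fun i _ => ?_
  have h1 : (∑ a ∈ S, F i a) ^ 2 ≤ q * ∑ a ∈ S, F i a ^ 2 := by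
    refine sq_sum_le_card_mul_sum_sq.trans ?_
    have : (S.card : ℝ) ≤ q := by exact_mod_cast hS
    have h2 : 0 ≤ ∑ a ∈ S, F i a ^ 2 := Finset.sum_nonneg fun _ _ => sq_nonneg _
    gcongr
  calc (q * ∑ a ∈ S, F i a) ^ 2 = (q : ℝ) ^ 2 * (∑ a ∈ S, F i a) ^ 2 := by ring
    _ ≤ (q : ℝ) ^ 2 * (q * ∑ a ∈ S, F i a ^ 2) := by gcongr
    _ = _ := by ring

/-- A `q`-multiplicative sequence of Gowers norm close to `1` is, on the multiples of
`q ^ (2 s + 1)`, a linear phase up to a perturbation of small variance. -/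
theorem exists_linear_phase_variance_le {q s : ℕ} (hq : 2 ≤ q) (hs : 2 ≤ s) :
    ∃ C : ℝ, 0 < C ∧ ∀ f : ℕ → ℂ, IsQMultiplicative q f → ∀ (ε : ℝ) (M : ℕ), 0 < ε → ε ≤ 1 →
      C * ε ≤ 1 → 1 - ε < gowersNorm s (q ^ (2 * s + 1 + M)) f →
        ∃ (α β : ℝ) (Z : ℕ → ℝ),
          (∀ n < q ^ M, f (q ^ (2 * s + 1) * n) = e (n * α + β + Z n)) ∧
          ∑ n ∈ Finset.range (q ^ M), Z n ^ 2 ≤ q ^ M * (C * ε) := by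
  have hq0 : 0 < q := by omega
  -- For `a + 1 < q` a window of width `s + 1` suffices, which covers all `M` digits. The case `a +
  -- 1 = q` needs width `s + 2` and loses one position, matching the `M - 1` links between
  -- consecutive digits.
  obtain ⟨C₁, hC₁0, hC₁⟩ := sum_secondDiff_finset_le hq hs (Finset.Ico 1 (q - 1)) (s + 1) (by
    intro a ha
    rw [Finset.mem_Ico] at ha
    refine ⟨ha.1, ?_, by omega⟩
    rw [pow_succ']
    have : a + 1 < q := by omega
    gcongr)
  obtain ⟨C₂, hC₂0, hC₂⟩ := sum_secondDiff_finset_le hq hs (Finset.Ico 1 q) (s + 2) (by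
    intro a ha
    rw [Finset.mem_Ico] at ha
    refine ⟨ha.1, ?_, by omega⟩
    calc (a + 1) * q ^ s ≤ q * q ^ s := by gcongr; omega
      _ = q ^ (s + 1) := (pow_succ' _ _).symm
      _ < q ^ (s + 2) := Nat.pow_lt_pow_right (by omega) (by omega))
  refine ⟨C₁ + C₂ + 2 * q ^ 3 * C₁ + 2 * q ^ 5 * C₂, by positivity, ?_⟩
  intro f hf ε M hε0 hε1 hCε hn
  have hp1 : 0 ≤ q ^ 3 * C₁ * ε := by positivity
  have hp2 : 0 ≤ q ^ 5 * C₂ * ε := by positivity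
  have hp3 : 0 ≤ C₁ * ε := by positivity
  have hp4 : 0 ≤ C₂ * ε := by positivity
  have h1 := hC₁ f hf ε _ hε0 hε1 (by linarith) hn
  have h2 := hC₂ f hf ε _ hε0 hε1 (by linarith) hn
  rw [show 2 * s + 1 + M + 1 - (s + 1 + (s + 1)) = M by omega] at h1
  rw [show 2 * s + 1 + M + 1 - (s + 1 + (s + 2)) = M - 1 by omega] at h2
  set g : ℕ → ℂ := fun n => f (q ^ (2 * s + 1) * n) with hgdef
  have hg : IsQMultiplicative q g := hf.comp_mul hq _
  have hdiff : ∀ j a, secondDiff q f (2 * s + 1 + j) a = secondDiff q g j a := by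
    intro j a
    simp only [secondDiff, hgdef, pow_add, mul_left_comm]
  simp only [hdiff] at h1 h2
  set c : ℕ → ℝ := fun j => q * ∑ a ∈ Finset.Ico 1 (q - 1), secondDiff q g j a with hc
  set d : ℕ → ℝ := fun j => q * ∑ a ∈ Finset.Ico 1 q, secondDiff q g j a with hd
  have hsc : ∑ j ∈ Finset.range M, c j ^ 2 ≤ (q : ℝ) ^ 3 * (C₁ * ε) :=
    sum_mul_sum_sq_le _ (by simp; omega) _ h1
  have hsd : ∑ j ∈ Finset.range (M - 1), d j ^ 2 ≤ (q : ℝ) ^ 3 * (C₂ * ε) :=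
    sum_mul_sum_sq_le _ (by simp) _ h2
  obtain ⟨α, y, hy, hα⟩ := exists_common_frequency hq hg.norm_eq_one M c d (by
    intro j _ a ha
    refine (norm_map_mul_sub_pow_le hg.norm_eq_one hg.map_zero j a).trans ?_
    have : Finset.Ico 1 a ⊆ Finset.Ico 1 (q - 1) := Finset.Ico_subset_Ico_right (by omega)
    have h3 := Finset.sum_le_sum_of_subset_of_nonneg this
      fun b _ _ => (norm_nonneg _ : 0 ≤ secondDiff q g j b)
    have h4 : (a : ℝ) ≤ q := by exact_mod_cast ha.le
    have h5 : 0 ≤ ∑ b ∈ Finset.Ico 1 a, secondDiff q g j b :=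
      Finset.sum_nonneg fun _ _ => norm_nonneg _
    exact mul_le_mul h4 h3 h5 (by positivity)) (by
    intro j _
    have h3 := norm_map_mul_sub_pow_le (q := q) hg.norm_eq_one hg.map_zero j q
    rwa [← pow_succ'] at h3)
  obtain ⟨β, Z, hZ, -, hZ2⟩ := exists_phase_variance_le hq hg α _ M hα
  refine ⟨α, β, Z, hZ, hZ2.trans ?_⟩
  gcongr
  calc ∑ j ∈ Finset.range M, (c j + q * |y j|) ^ 2
      ≤ ∑ j ∈ Finset.range M, (2 * c j ^ 2 + 2 * q ^ 2 * y j ^ 2) := by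
        refine Finset.sum_le_sum fun j _ => ?_
        rw [← sq_abs (y j)]
        nlinarith [sq_nonneg (c j - q * |y j|)]
    _ = 2 * ∑ j ∈ Finset.range M, c j ^ 2 + 2 * q ^ 2 * ∑ j ∈ Finset.range M, y j ^ 2 := by
        rw [Finset.sum_add_distrib, Finset.mul_sum, Finset.mul_sum]
    _ ≤ 2 * (q ^ 3 * (C₁ * ε)) + 2 * q ^ 2 * (q ^ 3 * (C₂ * ε)) := by
        gcongr
        exact hy.trans hsd
    _ ≤ _ := by nlinarith

theorem multiples_eq_image {q l M : ℕ} (hq : 2 ≤ q) :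
    {n ∈ Finset.range (q ^ (l + M)) | q ^ l ∣ n} =
      (Finset.range (q ^ M)).image fun n => q ^ l * n := by
  have hl : 0 < q ^ l := by positivity
  ext n
  simp only [Finset.mem_filter, Finset.mem_range, Finset.mem_image, pow_add]
  constructor
  · rintro ⟨hn, m, rfl⟩
    exact ⟨m, lt_of_mul_lt_mul_left hn (Nat.zero_le _), rfl⟩
  · rintro ⟨m, hm, rfl⟩
    exact ⟨by gcongr, dvd_mul_right _ _⟩

end QMult

theorem corollary4p2 (q s : ℕ) (hq : 2 ≤ q) (hs : 2 ≤ s) :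
    ∃ (l₀ : ℕ) (h : ℝ → ℝ) (C : ℝ),
      (∀ ε : ℝ, 0 < ε → 0 < h ε) ∧ Tendsto h (𝓝[>] 0) (𝓝 0) ∧ 0 < C ∧
      ∀ f : ℕ → ℂ, QMult.IsQMultiplicative q f →
        ∀ (ε : ℝ) (L : ℕ), 0 < ε → l₀ ≤ L → 1 - ε < QMult.gowersNorm s (q ^ L) f →
          ∃ α β : ℝ,
            QMult.AlmostEvery (h ε) {n ∈ Finset.range (q ^ L) | q ^ l₀ ∣ n} fun n =>
              ∃ θ : ℝ, |θ| ≤ C * h ε ∧ f n = QMult.e (n * α + β + θ) := by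
  classical
  obtain ⟨C, hC0, hC⟩ := QMult.exists_linear_phase_variance_le hq hs
  -- The exponent balances Chebyshev: threshold `η` and exceptional proportion `C * ε / η ^ 2` are
  -- both at most `η` when `η ^ 3 = (C + 1) * ε`. Taking `C + 1` makes `η ≤ 1` imply both `ε ≤ 1`
  -- and `C * ε ≤ 1`.
  refine ⟨2 * s + 1, fun ε => ((C + 1) * ε) ^ (1 / 3 : ℝ), 1, fun ε hε => by positivity, ?_,
    one_pos, ?_⟩
  · have h : Continuous fun ε : ℝ => ((C + 1) * ε) ^ (1 / 3 : ℝ) :=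
      (continuous_const.mul continuous_id).rpow_const fun _ => Or.inr (by norm_num)
    have h0 := h.tendsto 0
    rw [mul_zero, Real.zero_rpow (by norm_num)] at h0
    exact h0.mono_left nhdsWithin_le_nhds
  intro f hf ε L hε hL hnorm
  obtain ⟨M, rfl⟩ := Nat.exists_eq_add_of_le hL
  have hη0 : 0 < ((C + 1) * ε) ^ (1 / 3 : ℝ) := by positivity
  have hη3 : (((C + 1) * ε) ^ (1 / 3 : ℝ)) ^ 3 = (C + 1) * ε := by
    rw [← Real.rpow_natCast, ← Real.rpow_mul (by positivity)]
    norm_num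
  simp only
  set η := ((C + 1) * ε) ^ (1 / 3 : ℝ)
  have hl : 0 < q ^ (2 * s + 1) := by positivity
  -- For `η ≥ 1` every element may be exceptional.
  rcases le_or_gt 1 η with h1 | h1
  · refine ⟨0, 0, ?_⟩
    rw [QMult.AlmostEvery]
    refine le_trans ?_ (le_mul_of_one_le_left (Nat.cast_nonneg _) h1)
    rw [← Set.ncard_coe_finset]
    refine Nat.cast_le.2 (Set.ncard_le_ncard ?_ (Finset.finite_toSet _))
    exact fun n hn => hn.1
  have hη1 : (C + 1) * ε ≤ 1 := by
    rw [← hη3]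
    exact pow_le_one₀ hη0.le h1.le
  have hCε : 0 < C * ε := by positivity
  obtain ⟨α, β, Z, hZ, hZ2⟩ := hC f hf ε M hε (by linarith) (by linarith) hnorm
  refine ⟨α / (q ^ (2 * s + 1) : ℕ), β, ?_⟩
  rw [QMult.AlmostEvery, QMult.multiples_eq_image hq, Finset.card_image_of_injective _
    (fun a b hab => Nat.eq_of_mul_eq_mul_left hl hab), Finset.card_range]
  set S := (Finset.range (q ^ M)).filter fun n => η < |Z n|
  have hsub : {n | n ∈ (Finset.range (q ^ M)).image (fun n => q ^ (2 * s + 1) * n) ∧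
      ¬ ∃ θ : ℝ, |θ| ≤ 1 * η ∧ f n = QMult.e (n * (α / (q ^ (2 * s + 1) : ℕ)) + β + θ)} ⊆
      (S.image fun n => q ^ (2 * s + 1) * n : Finset ℕ) := by
    rintro n ⟨hn, hθ⟩
    obtain ⟨m, hm, rfl⟩ := Finset.mem_image.1 hn
    refine Finset.mem_coe.2 (Finset.mem_image.2 ⟨m, Finset.mem_filter.2 ⟨hm, ?_⟩, rfl⟩)
    by_contra! hle
    refine hθ ⟨Z m, by rwa [one_mul], ?_⟩
    rw [hZ m (Finset.mem_range.1 hm), Nat.cast_mul]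
    congr 3
    have : ((q ^ (2 * s + 1) : ℕ) : ℝ) ≠ 0 := by exact_mod_cast hl.ne'
    field_simp
  have hcard : ({n | n ∈ (Finset.range (q ^ M)).image (fun n => q ^ (2 * s + 1) * n) ∧
      ¬ ∃ θ : ℝ, |θ| ≤ 1 * η ∧
        f n = QMult.e (n * (α / (q ^ (2 * s + 1) : ℕ)) + β + θ)}.ncard : ℝ) ≤ S.card := by
    have h2 := Set.ncard_le_ncard hsub (Finset.finite_toSet _)
    rw [Set.ncard_coe_finset] at h2
    exact_mod_cast h2.trans Finset.card_image_le
  refine hcard.trans ?_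
  have h3 := (QMult.card_filter_lt_abs_mul_le (Finset.range (q ^ M)) Z hη0.le).trans hZ2
  refine le_of_mul_le_mul_right (h3.trans ?_) (by positivity : 0 < η ^ 2)
  calc (q : ℝ) ^ M * (C * ε) ≤ q ^ M * ((C + 1) * ε) := by gcongr; linarith
    _ = η * (q ^ M : ℕ) * η ^ 2 := by rw [← hη3]; push_cast; ring
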